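/- **Definitions.** For $g>0$ and $\lambda\ge 0$ let $\chi'^{\,2}_g(\lambda)$ be the non-central chi-squared distribution, i.e. the law of $Y'$ when $M\sim\mathrm{Poisson}(\lambda/2)$ and, conditionally on $M$, $Y'\sim\chi^2_{g+2M}$. For $D\ge 1$, $\underline\alpha=(\alpha_1,\dots,\alpha_{D+1})$ with all $\alpha_i>0$ and $\underline\lambda=(\lambda_1,\dots,\lambda_{D+1})$ with all $\lambda_i\ge 0$, let $Y'_1,\dots,Y'_{D+1}$ be independent with $Y'_i\sim\chi'^{\,2}_{2\alpha_i}(\lambda_i)$ and let $Y'^{+}=\sum_{i=1}^{D+1}Y'_i$. The $D$-variate Conditional Non-central Dirichlet distribution $\mathrm{CNcDir}^{D}(\underline\alpha,\underline\lambda)$ is the conditional distribution of $\left(\frac{Y'_1}{Y'^{+}},\dots,\frac{Y'_D}{Y'^{+}}\right)$ given $Y'^{+}=1$ (that is, the value at $y=1$ of a regular conditional distribution given $Y'^{+}=y$ that is weakly continuous at $y=1$). **Proposition (Aggregation property).** Let $(X''_1,\dots,X''_D)\sim\mathrm{CNcDir}^{D}(\underline\alpha,\underline\lambda)$ and put $X''_{D+1}=1-\sum_{i=1}^{D}X''_i$.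 Let $1\le m\le D$ and let $A_1,\dots,A_{m+1}$ be non-empty pairwise disjoint sets with union $\{1,\dots,D+1\}$. Then $$\Big(\sum_{i\in A_1}X''_i,\ \dots,\ \sum_{i\in A_m}X''_i\Big)\ \sim\ \mathrm{CNcDir}^{m}\Big(\Big(\sum_{i\in A_1}\alpha_i,\dots,\sum_{i\in A_{m+1}}\alpha_i\Big),\ \Big(\sum_{i\in A_1}\lambda_i,\dots,\sum_{i\in A_{m+1}}\lambda_i\Big)\Big).$$ -/

import Mathlib

open MeasureTheory ProbabilityTheory Filter Topology
open scoped NNReal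

noncomputable section

/-- The (central) chi-squared distribution with `g` degrees of freedom, i.e. the gamma
distribution with shape `g / 2` and rate `1 / 2`. -/
def chiSq (g : ℝ) : Measure ℝ := gammaMeasure (g / 2) (1 / 2)

/-- The non-central chi-squared distribution with `g` degrees of freedom and non-centrality
parameter `l`: the law of `Y'` when `M ~ Poisson(l / 2)` and `Y' | M ~ chiSq (g + 2 M)`. -/
def ncChiSq (g : ℝ) (l : ℝ≥0) : Measure ℝ :=
  (poissonMeasure (l / 2)).bind fun M : ℕ => chiSq (g + 2 * (M : ℝ))

/-- The measures `κ t` of a Markov kernel, as points of the space of probability measures with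
the topology of weak convergence. -/
def kernelLaw {E : Type*} [MeasurableSpace E] (κ : Kernel ℝ E) [IsMarkovKernel κ] (t : ℝ) :
    ProbabilityMeasure E := ⟨κ t, inferInstance⟩

/-- `ν` is the conditional law of `Z` given `S = s` under `P`: there is a regular conditional
distribution `κ` of `Z` given `S` (a Markov kernel disintegrating the joint law of `(S, Z)` over
the law of `S`) which is weakly continuous at the point `s`, and `κ s = ν`.
As `s` is required to lie in the topological support of the law of `S`, such a `ν` is unique
(`IsCondLawAt.unique`), also when `{S = s}` has probability zero. -/
def IsCondLawAt {Ω E : Type*} [MeasurableSpace Ω] [TopologicalSpace E] [MeasurableSpace E]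
    [OpensMeasurableSpace E] (P : Measure Ω) (Z : Ω → E) (S : Ω → ℝ) (s : ℝ)
    (ν : Measure E) : Prop :=
  s ∈ (P.map S).support ∧
  ∃ (κ : Kernel ℝ E) (_ : IsMarkovKernel κ),
    P.map (fun ω => (S ω, Z ω)) = (P.map S) ⊗ₘ κ ∧
    ContinuousAt (kernelLaw κ) s ∧
    κ s = ν

/-- The conditional law at a point is well defined. -/
theorem IsCondLawAt.unique {Ω : Type*} [MeasurableSpace Ω] {D : ℕ} {P : Measure Ω}
    [IsFiniteMeasure P] {Z : Ω → (Fin D → ℝ)} {S : Ω → ℝ} {s : ℝ} {ν ν' : Measure (Fin D → ℝ)}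
    (h : IsCondLawAt P Z S s ν) (h' : IsCondLawAt P Z S s ν') : ν = ν' := by
  obtain ⟨hs, κ, _, h1, h2, rfl⟩ := h
  obtain ⟨-, κ', _, h1', h2', rfl⟩ := h'
  have hae : κ =ᵐ[P.map S] κ' := Kernel.ae_eq_of_compProd_eq (h1.symm.trans h1')
  have hfr : ∃ᶠ t in 𝓝 s, κ t = κ' t := by
    intro hn
    have hpos := (Measure.mem_support_iff_forall s).1 hs _ hn
    exact hpos.ne' (ae_iff.1 hae)
  have heq : kernelLaw κ s = kernelLaw κ' s :=
    tendsto_nhds_unique_of_frequently_eq h2 h2' (hfr.mono fun t ht => Subtype.ext ht)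
  exact congrArg Subtype.val heq

/-- `ν` is the `D`-variate Conditional Non-central Dirichlet distribution `CNcDir^D(α, l)`: for
independent `Y'_i ~ ncChiSq (2 α_i) l_i`, `i = 1, …, D + 1`, with sum `Y'⁺`, it is the conditional
law of `(Y'_1 / Y'⁺, …, Y'_D / Y'⁺)` given `Y'⁺ = 1`. -/
def IsCNcDir {D : ℕ} (α : Fin (D + 1) → ℝ) (l : Fin (D + 1) → ℝ≥0)
    (ν : Measure (Fin D → ℝ)) : Prop :=
  IsCondLawAt (Measure.pi fun i => ncChiSq (2 * α i) (l i))
    (fun (y : Fin (D + 1) → ℝ) (i : Fin D) => y i.castSucc / ∑ j, y j)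
    (fun y => ∑ j, y j) 1 ν

/-- The random vector `X` is distributed according to `CNcDir^D(α, l)` under `P`. -/
def HasCNcDirLaw {Ω : Type*} [MeasurableSpace Ω] {D : ℕ} (X : Ω → (Fin D → ℝ))
    (α : Fin (D + 1) → ℝ) (l : Fin (D + 1) → ℝ≥0) (P : Measure Ω) : Prop :=
  AEMeasurable X P ∧ IsCNcDir α l (P.map X)

/-- The `D + 1` parts `(x_1, …, x_D, x_{D+1})` of the whole determined by `(x_1, …, x_D)`, where
`x_{D+1} = 1 - (x_1 + ⋯ + x_D)`. -/
def allParts {D : ℕ} (x : Fin D → ℝ) : Fin (D + 1) → ℝ :=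
  Fin.snoc x (1 - ∑ i, x i)

end

lemma integrable_gammaPDFReal {a r : ℝ} (ha : 0 < a) (hr : 0 < r) :
    Integrable (gammaPDFReal a r) := by
  refine ⟨(measurable_gammaPDFReal a r).aestronglyMeasurable, ?_⟩
  rw [hasFiniteIntegral_iff_ofReal (ae_of_all _ (gammaPDFReal_nonneg ha hr))]
  exact (lintegral_gammaPDF_eq_one ha hr).trans_lt ENNReal.one_lt_top

lemma integral_gammaPDFReal {a r : ℝ} (ha : 0 < a) (hr : 0 < r) :
    ∫ x, gammaPDFReal a r x = 1 := by
  rw [integral_eq_lintegral_of_nonneg_ae (ae_of_all _ (gammaPDFReal_nonneg ha hr))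
    (measurable_gammaPDFReal a r).aestronglyMeasurable]
  exact (congrArg ENNReal.toReal (lintegral_gammaPDF_eq_one ha hr)).trans ENNReal.toReal_one

/-- Exponential tilting of a gamma density yields a multiple of a gamma density. -/
lemma gammaPDFReal_mul_exp {a r t : ℝ} (hr : 0 < r) (ht : t < r) (x : ℝ) :
    gammaPDFReal a r x * Real.exp (t * x) =
      (1 - t / r) ^ (-a) * gammaPDFReal a (r - t) x := by
  unfold gammaPDFReal
  split_ifs
  · have hrt : 0 < r - t := sub_pos.2 ht
    have h1 : 1 - t / r = (r - t) / r := by field_simp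
    have h2 : Real.exp (-(r * x)) * Real.exp (t * x) = Real.exp (-((r - t) * x)) := by
      rw [← Real.exp_add]; ring_nf
    have h3 : (1 - t / r) ^ (-a) * (r - t) ^ a = r ^ a := by
      rw [h1, Real.rpow_neg (by positivity), Real.div_rpow hrt.le hr.le]
      have := (Real.rpow_pos_of_pos hrt a).ne'
      have := (Real.rpow_pos_of_pos hr a).ne'
      field_simp
    rw [← h2, ← h3]
    ring
  · simp

lemma gammaMeasure_eq_withDensity_ofReal (a r : ℝ) :
    gammaMeasure a r = volume.withDensity fun x => ENNReal.ofReal (gammaPDFReal a r x) := rfl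

lemma integrable_exp_mul_gammaMeasure {a r t : ℝ} (ha : 0 < a) (hr : 0 < r) (ht : t < r) :
    Integrable (fun x => Real.exp (t * x)) (gammaMeasure a r) := by
  rw [gammaMeasure_eq_withDensity_ofReal, integrable_withDensity_iff_integrable_smul'
    (measurable_gammaPDFReal a r).ennreal_ofReal (by simp)]
  simp only [ENNReal.toReal_ofReal (gammaPDFReal_nonneg ha hr _), smul_eq_mul,
    gammaPDFReal_mul_exp hr ht]
  exact (integrable_gammaPDFReal ha (sub_pos.2 ht)).const_mul _

lemma mgf_gammaMeasure {a r t : ℝ} (ha : 0 < a) (hr : 0 < r) (ht : t < r) :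
    mgf id (gammaMeasure a r) t = (1 - t / r) ^ (-a) := by
  rw [mgf, gammaMeasure_eq_withDensity_ofReal, integral_withDensity_eq_integral_toReal_smul
    (measurable_gammaPDFReal a r).ennreal_ofReal (by simp)]
  simp only [ENNReal.toReal_ofReal (gammaPDFReal_nonneg ha hr _), smul_eq_mul, id_eq,
    gammaPDFReal_mul_exp hr ht]
  rw [integral_const_mul, integral_gammaPDFReal ha (sub_pos.2 ht), mul_one]

lemma complexMGF_gammaMeasure {a r : ℝ} (ha : 0 < a) (hr : 0 < r) {z : ℂ} (hz : z.re < r) :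
    complexMGF id (gammaMeasure a r) z = (1 - z / r) ^ (-a : ℂ) := by
  have hsub : Set.Iio r ⊆ interior (integrableExpSet id (gammaMeasure a r)) :=
    interior_maximal (fun t ht => integrable_exp_mul_gammaMeasure ha hr ht) isOpen_Iio
  have hre (w : ℂ) (hw : w.re < r) : 0 < (1 - w / r).re := by
    rw [Complex.sub_re, Complex.one_re, Complex.div_ofReal_re, sub_pos, div_lt_one hr]
    exact hw
  have hconv : Convex ℝ {w : ℂ | w.re < r} := convex_halfSpace_re_lt r
  refine AnalyticOnNhd.eqOn_of_preconnected_of_frequently_eq (z₀ := 0)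
    (U := {w : ℂ | w.re < r}) (g := fun w : ℂ => (1 - w / r) ^ (-a : ℂ))
    (fun w hw => analyticAt_complexMGF (hsub hw)) (fun w hw => ?_) hconv.isPreconnected
    (by simpa using hr) ?_ hz
  · exact AnalyticAt.cpow (by fun_prop) analyticAt_const (Or.inl (hre w hw))
  · have hlim : Tendsto (fun x : ℝ => (x : ℂ)) (𝓝[≠] 0) (𝓝[≠] 0) := by
      refine tendsto_nhdsWithin_iff.2 ⟨?_, ?_⟩
      · exact (Complex.continuous_ofReal.tendsto' 0 0 (by simp)).mono_left nhdsWithin_le_nhds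
      · filter_upwards [self_mem_nhdsWithin] with x hx
        simpa using hx
    refine hlim.frequently (Eventually.frequently ?_)
    filter_upwards [nhdsWithin_le_nhds (Iio_mem_nhds hr)] with x hx
    have h0 : 0 ≤ 1 - x / r := by
      have := hre x (by simpa using hx)
      exact_mod_cast this.le
    rw [complexMGF_ofReal, mgf_gammaMeasure ha hr hx, Complex.ofReal_cpow h0]
    push_cast
    rfl

lemma charFun_gammaMeasure {a r : ℝ} (ha : 0 < a) (hr : 0 < r) (t : ℝ) :
    charFun (gammaMeasure a r) t = (1 - t * Complex.I / r) ^ (-a : ℂ) := by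
  rw [← complexMGF_id_mul_I, complexMGF_gammaMeasure ha hr (by simpa using hr)]

lemma isProbabilityMeasure_chiSq {g : ℝ} (hg : 0 < g) : IsProbabilityMeasure (chiSq g) :=
  isProbabilityMeasure_gammaMeasure (by positivity) (by norm_num)

lemma isProbabilityMeasure_ncChiSq {g : ℝ} (hg : 0 < g) (l : ℝ≥0) :
    IsProbabilityMeasure (ncChiSq g l) := by
  refine ⟨?_⟩
  have (M : ℕ) : chiSq (g + 2 * (M : ℝ)) Set.univ = 1 :=
    (isProbabilityMeasure_chiSq (by positivity)).measure_univ
  rw [ncChiSq, Measure.bind_apply .univ (measurable_of_countable _).aemeasurable]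
  simp [this]

lemma ncChiSq_singleton (g : ℝ) (l : ℝ≥0) (x : ℝ) : ncChiSq g l {x} = 0 := by
  rw [ncChiSq, Measure.bind_apply (measurableSet_singleton x)
    (measurable_of_countable _).aemeasurable]
  simp [chiSq, gammaMeasure]

lemma charFun_chiSq {g : ℝ} (hg : 0 < g) (t : ℝ) :
    charFun (chiSq g) t = (1 - 2 * t * Complex.I) ^ (-(g / 2) : ℂ) := by
  rw [chiSq, charFun_gammaMeasure (by positivity) (by norm_num)]
  push_cast
  congr 2
  ring

lemma integral_bind_countable {ι E F : Type*} [Countable ι] [MeasurableSpace ι]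
    [MeasurableSingletonClass ι] [MeasurableSpace E] [NormedAddCommGroup F] [NormedSpace ℝ F]
    {μ : Measure ι} [SFinite μ] {κ : ι → Measure E} (hκ : ∀ i, IsProbabilityMeasure (κ i))
    {f : E → F} (hf : Integrable f (μ.bind κ)) :
    ∫ x, f x ∂(μ.bind κ) = ∫ i, ∫ x, f x ∂κ i ∂μ := by
  let K : Kernel ι E := ⟨κ, measurable_of_countable _⟩
  have : IsMarkovKernel K := ⟨hκ⟩
  have hbind : μ.bind κ = (μ ⊗ₘ K).map Prod.snd := (Measure.snd_compProd μ K).symm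
  rw [hbind] at hf ⊢
  rw [integral_map measurable_snd.aemeasurable hf.aestronglyMeasurable,
    Measure.integral_compProd (f := fun p => f p.2) (hf.comp_measurable measurable_snd)]
  rfl

/-- The characteristic function of the non-central chi-squared distribution. -/
lemma charFun_ncChiSq {g : ℝ} (hg : 0 < g) (l : ℝ≥0) (t : ℝ) :
    charFun (ncChiSq g l) t = (1 - 2 * t * Complex.I) ^ (-(g / 2) : ℂ) *
      Complex.exp (l / 2 * ((1 - 2 * t * Complex.I)⁻¹ - 1)) := by
  have := isProbabilityMeasure_ncChiSq hg l
  set w : ℂ := 1 - 2 * t * Complex.I with hw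
  have hw0 : w ≠ 0 := fun h => by simpa [hw] using congrArg Complex.re h
  have hint : Integrable (fun x : ℝ => Complex.exp (t * x * Complex.I)) (ncChiSq g l) := by
    refine (integrable_const (1 : ℝ)).mono (by fun_prop) (ae_of_all _ fun x => ?_)
    rw [← Complex.ofReal_mul, Complex.norm_exp_ofReal_mul_I, norm_one]
  rw [charFun_apply_real, ncChiSq, integral_bind_countable
    (fun M => isProbabilityMeasure_chiSq (by positivity)) hint]
  simp_rw [← charFun_apply_real]
  have hterm (M : ℕ) : charFun (chiSq (g + 2 * (M : ℝ))) t = w ^ (-(g / 2) : ℂ) * w⁻¹ ^ M := by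
    rw [charFun_chiSq (by positivity), ← hw, inv_pow, ← Complex.cpow_natCast, ← Complex.cpow_neg,
      ← Complex.cpow_add _ _ hw0]
    congr 1
    push_cast
    ring
  simp_rw [hterm]
  rw [integral_const_mul, integral_poissonMeasure]
  congr 1
  calc ∑' n : ℕ, (Real.exp (-↑(l / 2)) * ↑(l / 2) ^ n / n.factorial : ℝ) • w⁻¹ ^ n
      = ∑' n : ℕ, Complex.exp (-(l / 2)) * ((l / 2 * w⁻¹) ^ n / n.factorial) := by
        congr with n
        rw [Complex.real_smul]
        push_cast
        ring
    _ = Complex.exp (l / 2 * (w⁻¹ - 1)) := by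
        rw [tsum_mul_left, (NormedSpace.expSeries_div_hasSum_exp (l / 2 * w⁻¹ : ℂ)).tsum_eq,
          ← Complex.exp_eq_exp_ℂ, ← Complex.exp_add]
        ring_nf

/-- The non-central chi-squared family is closed under convolution, in terms of characteristic
functions. -/
lemma prod_charFun_ncChiSq {ι : Type*} {s : Finset ι} (hs : s.Nonempty) {α : ι → ℝ}
    (hα : ∀ i, 0 < α i) (l : ι → ℝ≥0) (t : ℝ) :
    ∏ i ∈ s, charFun (ncChiSq (2 * α i) (l i)) t =
      charFun (ncChiSq (2 * ∑ i ∈ s, α i) (∑ i ∈ s, l i)) t := by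
  induction hs using Finset.Nonempty.cons_induction with
  | singleton i => simp
  | cons i s hi hs ih =>
    have h1 : 0 < 2 * α i := mul_pos two_pos (hα i)
    have h2 : 0 < 2 * ∑ i ∈ s, α i := mul_pos two_pos (Finset.sum_pos (fun i _ => hα i) hs)
    have hw0 : (1 - 2 * t * Complex.I : ℂ) ≠ 0 := fun h => by simpa using congrArg Complex.re h
    rw [Finset.prod_cons, ih, Finset.sum_cons, Finset.sum_cons, charFun_ncChiSq h1,
      charFun_ncChiSq h2, charFun_ncChiSq (by rw [mul_add]; exact add_pos h1 h2),
      mul_mul_mul_comm, ← Complex.cpow_add _ _ hw0, ← Complex.exp_add]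
    congr 2
    · push_cast
      ring
    · push_cast
      ring

/-- Sums over the blocks of a family of index sets. -/
def blockSum {ι κ : Type*} (A : κ → Finset ι) : (ι → ℝ) →L[ℝ] (κ → ℝ) :=
  ContinuousLinearMap.pi fun k => ∑ i ∈ A k, ContinuousLinearMap.proj i

lemma blockSum_apply {ι κ : Type*} (A : κ → Finset ι) (y : ι → ℝ) (k : κ) :
    blockSum A y k = ∑ i ∈ A k, y i := by
  simp [blockSum]

@[to_additive]
lemma prod_blocks {ι κ M : Type*} [Fintype ι] [Fintype κ] [CommMonoid M] {A : κ → Finset ι}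
    (hdisj : Pairwise fun k k' => Disjoint (A k) (A k')) (hcover : ∀ i, ∃ k, i ∈ A k)
    (f : ι → M) : ∏ k, ∏ i ∈ A k, f i = ∏ i, f i := by
  classical
  rw [← Finset.prod_biUnion fun k _ k' _ h => hdisj h]
  congr 1
  ext i
  simpa using hcover i

/-- Block sums of independent non-central chi-squared variables are independent non-central
chi-squared variables. -/
lemma map_blockSum_pi_ncChiSq {ι κ : Type*} [Fintype ι] [Fintype κ] {A : κ → Finset ι}
    (hdisj : Pairwise fun k k' => Disjoint (A k) (A k')) (hcover : ∀ i, ∃ k, i ∈ A k)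
    (hne : ∀ k, (A k).Nonempty) {α : ι → ℝ} (hα : ∀ i, 0 < α i)
    (l : ι → ℝ≥0) :
    (Measure.pi fun i => ncChiSq (2 * α i) (l i)).map (blockSum A) =
      Measure.pi fun k => ncChiSq (2 * ∑ i ∈ A k, α i) (∑ i ∈ A k, l i) := by
  classical
  have (i : ι) : IsProbabilityMeasure (ncChiSq (2 * α i) (l i)) :=
    isProbabilityMeasure_ncChiSq (mul_pos two_pos (hα i)) _
  have (k : κ) : IsProbabilityMeasure (ncChiSq (2 * ∑ i ∈ A k, α i) (∑ i ∈ A k, l i)) :=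
    isProbabilityMeasure_ncChiSq
      (mul_pos two_pos (Finset.sum_pos (fun i _ => hα i) (hne k))) _
  have hdual (μ : Measure ℝ) (L : StrongDual ℝ ℝ) : charFunDual μ L = charFun μ (L 1) := by
    have hL (v : ℝ) : L v = L 1 * v := by
      rw [mul_comm, ← smul_eq_mul v, ← L.map_smul, smul_eq_mul, mul_one]
    rw [charFunDual_apply, charFun_apply_real]
    refine integral_congr_ae (ae_of_all _ fun v => ?_)
    dsimp only
    rw [hL v, Complex.ofReal_mul]
  refine Measure.ext_of_charFunDual (funext fun L => ?_)
  rw [charFunDual_map, charFunDual_pi, charFunDual_pi, ← prod_blocks hdisj hcover]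
  refine Finset.prod_congr rfl fun k _ => ?_
  rw [hdual, ← prod_charFun_ncChiSq (hne k) hα]
  refine Finset.prod_congr rfl fun i hi => ?_
  rw [hdual]
  congr 1
  simp only [ContinuousLinearMap.comp_apply]
  congr 1
  ext k'
  rw [blockSum_apply]
  simp only [ContinuousLinearMap.single_apply, Pi.single_apply, Finset.sum_ite_eq']
  refine if_congr ⟨fun h => ?_, ?_⟩ rfl rfl
  · by_contra hk
    exact Finset.disjoint_left.1 (hdisj hk) h hi
  · rintro rfl
    exact hi

lemma ae_sum_ne_zero_pi_ncChiSq {ι : Type*} [Fintype ι] [Nonempty ι] {α : ι → ℝ}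
    (hα : ∀ i, 0 < α i) (l : ι → ℝ≥0) :
    ∀ᵐ y ∂(Measure.pi fun i => ncChiSq (2 * α i) (l i)), ∑ i, y i ≠ 0 := by
  have := fun i => isProbabilityMeasure_ncChiSq (mul_pos two_pos (hα i)) (l i)
  have := isProbabilityMeasure_ncChiSq
    (mul_pos two_pos (Finset.sum_pos (fun i _ => hα i) Finset.univ_nonempty)) (∑ i, l i)
  have hm : Measurable fun y : ι → ℝ => ∑ i, y i := by fun_prop
  have hmap : (Measure.pi fun i => ncChiSq (2 * α i) (l i)).map (fun y => ∑ i, y i) =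
      ncChiSq (2 * ∑ i, α i) (∑ i, l i) := by
    refine Measure.ext_of_charFun (funext fun t => ?_)
    rw [charFun_map_sum_pi_eq_prod, Finset.prod_apply,
      prod_charFun_ncChiSq Finset.univ_nonempty hα]
  have h0 := ncChiSq_singleton (2 * ∑ i, α i) (∑ i, l i) 0
  rw [← hmap, Measure.map_apply hm (measurableSet_singleton 0)] at h0
  exact measure_eq_zero_iff_ae_notMem.1 h0

lemma continuous_allParts {D : ℕ} : Continuous (allParts (D := D)) := by
  unfold allParts
  fun_prop

lemma allParts_div {D : ℕ} {y : Fin (D + 1) → ℝ} (hy : ∑ j, y j ≠ 0) (i : Fin (D + 1)) :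
    allParts (fun i : Fin D => y i.castSucc / ∑ j, y j) i = y i / ∑ j, y j := by
  induction i using Fin.lastCases with
  | last =>
    rw [allParts, Fin.snoc_last, ← Finset.sum_div, eq_div_iff hy, sub_mul, div_mul_cancel₀ _ hy,
      one_mul, Fin.sum_univ_castSucc, add_sub_cancel_left]
  | cast i => rw [allParts, Fin.snoc_castSucc]

/-- Conditional laws are preserved by continuous transformations. -/
lemma IsCondLawAt.map {Ω E F : Type*} [MeasurableSpace Ω] [TopologicalSpace E] [MeasurableSpace E]
    [OpensMeasurableSpace E] [TopologicalSpace F] [MeasurableSpace F] [BorelSpace F]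
    {P : Measure Ω} [IsFiniteMeasure P] {Z : Ω → E} {S : Ω → ℝ} {s : ℝ} {ν : Measure E}
    (h : IsCondLawAt P Z S s ν) (hZ : Measurable Z) (hS : Measurable S) {f : E → F}
    (hf : Continuous f) : IsCondLawAt P (f ∘ Z) S s (ν.map f) := by
  obtain ⟨hs, κ, _, hdis, hcont, rfl⟩ := h
  have hfm := hf.measurable
  have : IsMarkovKernel (κ.map f) := Kernel.IsMarkovKernel.map κ hfm
  refine ⟨hs, κ.map f, this, ?_, ?_, Kernel.map_apply κ hfm s⟩
  · rw [Measure.compProd_map hfm, ← hdis, Measure.map_map (by fun_prop) (by fun_prop)]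
    rfl
  · have heq : kernelLaw (κ.map f) =
        fun t => (kernelLaw κ t).map hf.measurable.aemeasurable :=
      funext fun t => Subtype.ext (Kernel.map_apply κ hfm t)
    rw [heq]
    exact (ProbabilityMeasure.continuous_map hf).continuousAt.comp hcont

lemma IsCondLawAt.congr_ae {Ω E : Type*} [MeasurableSpace Ω] [TopologicalSpace E]
    [MeasurableSpace E] [OpensMeasurableSpace E] {P : Measure Ω} {Z Z' : Ω → E} {S : Ω → ℝ}
    {s : ℝ} {ν : Measure E} (h : IsCondLawAt P Z S s ν) (hZ : Z =ᵐ[P] Z') :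
    IsCondLawAt P Z' S s ν := by
  obtain ⟨hs, κ, hκ, hdis, hcont, hν⟩ := h
  refine ⟨hs, κ, hκ, ?_, hcont, hν⟩
  rw [← hdis]
  exact Measure.map_congr (hZ.mono fun ω hω => by simp only [hω])

lemma IsCondLawAt.of_comp {Ω Ω' E : Type*} [MeasurableSpace Ω] [MeasurableSpace Ω']
    [TopologicalSpace E] [MeasurableSpace E] [OpensMeasurableSpace E] {P : Measure Ω}
    {Z : Ω' → E} {S : Ω' → ℝ} {s : ℝ} {ν : Measure E} {g : Ω → Ω'} (hg : Measurable g)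
    (hZ : Measurable Z) (hS : Measurable S)
    (h : IsCondLawAt P (Z ∘ g) (S ∘ g) s ν) : IsCondLawAt (P.map g) Z S s ν := by
  obtain ⟨hs, κ, hκ, hdis, hcont, hν⟩ := h
  rw [← Measure.map_map hS hg] at hs hdis
  refine ⟨hs, κ, hκ, ?_, hcont, hν⟩
  rw [← hdis, Measure.map_map (by fun_prop) hg]
  rfl

theorem mainTheorem4 {Ω : Type*} [MeasurableSpace Ω] (P : Measure Ω) [IsProbabilityMeasure P]
    (D m : ℕ) (hm : 1 ≤ m) (hmD : m ≤ D)
    (α : Fin (D + 1) → ℝ) (hα : ∀ i, 0 < α i) (l : Fin (D + 1) → ℝ≥0)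
    (X : Ω → (Fin D → ℝ)) (hX : HasCNcDirLaw X α l P)
    (A : Fin (m + 1) → Finset (Fin (D + 1)))
    (hne : ∀ k, (A k).Nonempty)
    (hdisj : Pairwise fun k k' => Disjoint (A k) (A k'))
    (hcover : ∀ i, ∃ k, i ∈ A k) :
    HasCNcDirLaw (fun ω (k : Fin m) => ∑ i ∈ A k.castSucc, allParts (X ω) i)
      (fun k => ∑ i ∈ A k, α i) (fun k => ∑ i ∈ A k, l i) P := by
  obtain ⟨hXm, hlaw⟩ := hX
  have (i : Fin (D + 1)) : IsProbabilityMeasure (ncChiSq (2 * α i) (l i)) :=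
    isProbabilityMeasure_ncChiSq (mul_pos two_pos (hα i)) _
  let f : (Fin D → ℝ) → (Fin m → ℝ) := fun x k => ∑ i ∈ A k.castSucc, allParts x i
  have hf : Continuous f := continuous_pi fun k => continuous_finsetSum _ fun i _ =>
    (continuous_apply i).comp continuous_allParts
  refine ⟨hf.measurable.comp_aemeasurable hXm, ?_⟩
  have hmap : P.map (fun ω (k : Fin m) => ∑ i ∈ A k.castSucc, allParts (X ω) i) =
      (P.map X).map f := (AEMeasurable.map_map_of_aemeasurable hf.measurable.aemeasurable hXm).symm
  rw [hmap, IsCNcDir, ← map_blockSum_pi_ncChiSq hdisj hcover hne hα l]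
  refine IsCondLawAt.of_comp (blockSum A).continuous.measurable (by fun_prop) (by fun_prop) ?_
  have hsum : (fun y : Fin (m + 1) → ℝ => ∑ k, y k) ∘ blockSum A = fun y => ∑ i, y i := by
    funext y
    simp only [Function.comp_apply, blockSum_apply]
    exact sum_blocks hdisj hcover y
  rw [hsum]
  refine (IsCondLawAt.map hlaw (by fun_prop) (by fun_prop) hf).congr_ae ?_
  filter_upwards [ae_sum_ne_zero_pi_ncChiSq hα l] with y hy
  funext k
  have hs : ∑ k, blockSum A y k = ∑ i, y i := congrFun hsum y
  simp only [Function.comp_apply, hs]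
  simp only [f, allParts_div hy, blockSum_apply, Finset.sum_div]
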